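/- Let $d\ge 2$, $T\ge 1$, let $\mathcal W=\{w\in\mathbb R^d: w_i\ge 0,\ \sum_i w_i=1\}$ and $r(w)=\sum_{i=1}^d w_i\log(d\,w_i)$ (with $0\log 0=0$). Fix a step size $\eta>0$ and exploration parameters $\delta_1,\dots,\delta_T>0$. The algorithm starts with $\theta_1=0$ and, for $t=1,\dots,T$: * predicts $w_t=\arg\max_{w\in\mathcal W}\,\langle\theta_t,w\rangle-r(w)$; * draws $u_t$ uniformly from the Euclidean unit sphere of $\mathbb R^d$; * queries the loss $f_t$ at $w_t\pm\delta_t u_t$ and sets $\tilde g_t=\frac{d}{2\delta_t}\bigl(f_t(w_t+\delta_t u_t)-f_t(w_t-\delta_t u_t)\bigr)u_t$; * updates $\theta_{t+1}=\theta_t-\eta\,\tilde g_t$. Each $f_t:\mathbb R^d\to\mathbb R$ is convex and $G_1$-Lipschitz with respect to the $1$-norm, where $G_1>0$. The adversary may randomize and may choose $f_t$ depending on the past ($u_1,\dots,u_{t-1}$); $u_t$ is independent of $u_1,\dots,u_{t-1}$ and $f_1,\dots,f_t$. Write $m_d=\bigl(\mathbb E\|u\|_\infty^4\bigr)^{1/4}$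 for $u$ uniform on the unit sphere of $\mathbb R^d$. 1. There is a numerical constant $c_0>0$ such that $m_d\le c_0\sqrt{\log(d)/d}$ for all $d\ge 2$. 2. For every constant $C$ there is a constant $c>0$, depending only on $C$, such that the following holds for all $d\ge2$, $T\ge1$, $G_1>0$ and all losses as above. Let $m_d\le p_*\le C\sqrt{\log(d)/d}$, put $R=\sqrt{\log d}$ and $G_2=\sqrt d\,G_1$, and run the algorithm with $\eta=\dfrac{R}{p_*G_2\sqrt{dT}}$ and any $0<\delta_t\le p_*R\sqrt{d/T}$. Then for every $w^*\in\mathcal W$ the average regret $\frac1T\sum_{t=1}^T f_t(w_t)-\frac1T\sum_{t=1}^T f_t(w^*)$ is integrable and $$\mathbb E\left[\frac1T\sum_{t=1}^T f_t(w_t)-\frac1T\sum_{t=1}^T f_t(w^*)\right]\le c\,G_1\sqrt{\frac{d\log^2 d}{T}} .$$ In particular, with $C=c_0$ one may take $p_*=m_d$ or $p_*=c_0\sqrt{\log(d)/d}$, and $c$ is a numerical constant. -/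

import Mathlib

open MeasureTheory ProbabilityTheory

namespace TwoPointBandit

noncomputable section

/-- The uniform probability distribution on the Euclidean unit sphere of `ℝ^d`, as a measure on
`ℝ^d`: the normalized surface measure. -/
def uniformSphere (d : ℕ) : Measure (EuclideanSpace ℝ (Fin d)) :=
  (((volume : Measure (EuclideanSpace ℝ (Fin d))).toSphere Set.univ)⁻¹ •
    (volume : Measure (EuclideanSpace ℝ (Fin d))).toSphere).map Subtype.val

/-- The fourth-moment quantity `(E ‖u‖_∞ ^ 4) ^ (1/4)` for `u` uniform on the unit sphere
(the norm of `Fin d → ℝ` is the sup norm, the dual of the 1-norm). -/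
def supNormFourthMoment (d : ℕ) : ℝ :=
  (∫ u, ‖(WithLp.ofLp u : Fin d → ℝ)‖ ^ 4 ∂(uniformSphere d)) ^ (1 / 4 : ℝ)

/-- The probability simplex in `ℝ^d`. -/
def simplex (d : ℕ) : Set (EuclideanSpace ℝ (Fin d)) :=
  {w | WithLp.ofLp w ∈ stdSimplex ℝ (Fin d)}

/-- The entropic regularizer `r(w) = ∑ i, w_i log (d w_i)` (with `0 log 0 = 0`). -/
def entropicReg (d : ℕ) (w : EuclideanSpace ℝ (Fin d)) : ℝ :=
  ∑ i, w i * Real.log (d * w i)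

/-- `f` is `G`-Lipschitz with respect to the 1-norm on `ℝ^d`. -/
def IsLipschitzL1 {d : ℕ} (G : ℝ) (f : EuclideanSpace ℝ (Fin d) → ℝ) : Prop :=
  ∀ x y, |f x - f y| ≤ G * ∑ i, |x i - y i|

/-- The two-point gradient estimate `d / (2δ) * (f (w + δ u) - f (w - δ u)) * u`. -/
def gradEstimate {d : ℕ} (δ : ℝ) (f : EuclideanSpace ℝ (Fin d) → ℝ)
    (w u : EuclideanSpace ℝ (Fin d)) : EuclideanSpace ℝ (Fin d) :=
  ((d : ℝ) / (2 * δ) * (f (w + δ • u) - f (w - δ • u))) • u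

/-- `w` (predictions) and `θ` (dual iterates) form a run over `T` rounds, numbered `0, …, T - 1`,
of the two-point bandit convex optimization algorithm with domain `W`, regularizer `r`, step size
`η` and exploration parameters `δ`, on the losses `f`, when the sampled directions are `u`. -/
structure IsRun {d : ℕ} (W : Set (EuclideanSpace ℝ (Fin d)))
    (r : EuclideanSpace ℝ (Fin d) → ℝ) (η : ℝ) (δ : ℕ → ℝ) (T : ℕ)
    (f : ℕ → EuclideanSpace ℝ (Fin d) → ℝ)
    (u θ w : ℕ → EuclideanSpace ℝ (Fin d)) : Prop where
  init : θ 0 = 0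
  predict_mem : ∀ t < T, w t ∈ W
  predict_max : ∀ t < T, IsMaxOn (fun v => inner ℝ (θ t) v - r v) W (w t)
  update : ∀ t < T, θ (t + 1) = θ t - η • gradEstimate (δ t) (f t) (w t) (u t)

/-- The randomness of the game over `T` rounds. `ℱ t` is the information available before the
direction `u t` is drawn: the loss `f t` may depend on it in any (measurable) way, so the adversary
may be randomized and may react to the past, while `u t` is uniform on the unit sphere and
independent of it, and is known from round `t + 1` on. -/
structure IsGame {d : ℕ} {Ω : Type*} [mΩ : MeasurableSpace Ω] (μ : Measure Ω)
    (ℱ : Filtration ℕ mΩ) (T : ℕ) (f : ℕ → Ω → EuclideanSpace ℝ (Fin d) → ℝ)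
    (u : ℕ → Ω → EuclideanSpace ℝ (Fin d)) : Prop where
  loss_measurable : ∀ t < T, ∀ x, Measurable[ℱ t] (fun ω => f t ω x)
  dir_measurable : ∀ t < T, Measurable[ℱ (t + 1)] (u t)
  dir_law : ∀ t < T, μ.map (u t) = uniformSphere d
  dir_indep : ∀ t < T, Indep (MeasurableSpace.comap (u t) inferInstance) (ℱ t) μ

end

end TwoPointBandit

namespace TwoPointBandit

/-! ### The uniform distribution on the sphere -/

/-! The uniform law on the sphere is used only through its invariance under linear isometries: sign
flips and reflections replace densities and the divergence theorem.

Averaging over sign flips makes the signs of the coordinates independent fair coins once the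
absolute values are fixed. This gives two estimates. A coordinate scaled by `√d` has the same law as
an inner product with a constant-sign vector, hence is sub-Gaussian, and a union bound gives
`supNormFourthMoment_le`. Also, `f (x + δ u) - f (x - δ u)` is odd in the signs and flipping one
sign changes it little, so Efron–Stein (`cubeMean_sq_le`) bounds its second moment. Since flips
preserve the sup norm, that factor comes out of the sign average, giving
`integral_supNorm_gradEstimate_sq_le`.

The bias of the estimate is controlled by pairing `u` with its reflection in the hyperplane
orthogonal to `x - y`: the two query points differ along `x - y`, where convexity bounds the
increment of `f` (`sub_le_integral_inner_gradEstimate`).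

The maximizer over the simplex is the softmax of `θ`, so the log-partition function is a potential
and yields a pathwise regret bound (`IsRun.sum_inner_le`). Conditioning on the past combines this
with the two one-round estimates in `expected_regret_le`; the prescribed `η`, `δ` balance the
resulting three terms. -/

open scoped Pointwise in
theorem toSphere_preimage_isometry {d : ℕ}
    (L : EuclideanSpace ℝ (Fin d) ≃ₗᵢ[ℝ] EuclideanSpace ℝ (Fin d))
    {A : Set (EuclideanSpace ℝ (Fin d))} (hA : MeasurableSet A) :
    (volume : Measure (EuclideanSpace ℝ (Fin d))).toSphere (Subtype.val ⁻¹' (L ⁻¹' A)) =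
      (volume : Measure (EuclideanSpace ℝ (Fin d))).toSphere (Subtype.val ⁻¹' A) := by
  have hL : Measurable L := L.continuous.measurable
  rw [Measure.toSphere_apply' _ (measurable_subtype_coe (hL hA)),
    Measure.toSphere_apply' _ (measurable_subtype_coe hA)]
  congr 1
  -- Surface measure is a multiple of the volume of the cone over a set, and forming the cone
  -- commutes with a linear isometry.
  have key : Set.Ioo (0 : ℝ) 1 • (Subtype.val '' (Subtype.val ⁻¹' (L ⁻¹' A) :
        Set (Metric.sphere (0 : EuclideanSpace ℝ (Fin d)) 1))) =
      L.toMeasurableEquiv ⁻¹' (Set.Ioo (0 : ℝ) 1 • (Subtype.val '' (Subtype.val ⁻¹' A :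
        Set (Metric.sphere (0 : EuclideanSpace ℝ (Fin d)) 1)))) := by
    ext x
    simp only [Set.mem_smul, Subtype.image_preimage_coe, Set.mem_inter_iff, Set.mem_preimage,
      mem_sphere_zero_iff_norm]
    constructor
    · rintro ⟨r, hr, y, ⟨hy, hyA⟩, rfl⟩
      exact ⟨r, hr, L y, ⟨by simpa using hy, hyA⟩, by simp⟩
    · rintro ⟨r, hr, y, ⟨hy, hyA⟩, h⟩
      refine ⟨r, hr, L.symm y, ⟨by simpa using hy, by simpa using hyA⟩, ?_⟩
      apply L.injective
      simpa using h
  rw [key]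
  exact L.measurePreserving.measure_preimage_equiv (f := L.toMeasurableEquiv) _

theorem map_uniformSphere {d : ℕ}
    (L : EuclideanSpace ℝ (Fin d) ≃ₗᵢ[ℝ] EuclideanSpace ℝ (Fin d)) :
    (uniformSphere d).map L = uniformSphere d := by
  have hL : Measurable L := L.continuous.measurable
  ext A hA
  rw [Measure.map_apply hL hA, uniformSphere, Measure.map_apply measurable_subtype_coe (hL hA),
    Measure.map_apply measurable_subtype_coe hA, Measure.smul_apply, Measure.smul_apply,
    toSphere_preimage_isometry L hA]

theorem integral_uniformSphere_comp {d : ℕ}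
    (L : EuclideanSpace ℝ (Fin d) ≃ₗᵢ[ℝ] EuclideanSpace ℝ (Fin d))
    (φ : EuclideanSpace ℝ (Fin d) → ℝ) :
    ∫ u, φ (L u) ∂(uniformSphere d) = ∫ u, φ u ∂(uniformSphere d) := by
  conv_rhs => rw [← map_uniformSphere L]
  exact (integral_map_equiv L.toMeasurableEquiv φ).symm

instance isProbabilityMeasure_uniformSphere {d : ℕ} [NeZero d] :
    IsProbabilityMeasure (uniformSphere d) := by
  have h0 : (volume : Measure (EuclideanSpace ℝ (Fin d))).toSphere Set.univ ≠ 0 := by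
    rw [Measure.measure_univ_ne_zero]
    exact Measure.toSphere_ne_zero _
  have : IsProbabilityMeasure
      (((volume : Measure (EuclideanSpace ℝ (Fin d))).toSphere Set.univ)⁻¹ •
        (volume : Measure (EuclideanSpace ℝ (Fin d))).toSphere) :=
    ⟨by rw [Measure.smul_apply, smul_eq_mul, ENNReal.inv_mul_cancel h0 (measure_ne_top _ _)]⟩
  exact Measure.isProbabilityMeasure_map measurable_subtype_coe.aemeasurable

theorem ae_norm_eq_one (d : ℕ) : ∀ᵐ u ∂(uniformSphere d), ‖u‖ = 1 := by
  rw [uniformSphere, ae_map_iff measurable_subtype_coe.aemeasurable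
    (measurableSet_eq_fun measurable_norm measurable_const)]
  exact Filter.Eventually.of_forall fun u => by simp

theorem integrable_uniformSphere {d : ℕ} [NeZero d] {φ : EuclideanSpace ℝ (Fin d) → ℝ}
    (hφ : Continuous φ) : Integrable φ (uniformSphere d) := by
  obtain ⟨C, hC⟩ := (isCompact_sphere (0 : EuclideanSpace ℝ (Fin d)) 1).exists_bound_of_continuousOn
    hφ.continuousOn
  refine Integrable.of_bound hφ.aestronglyMeasurable C ?_
  filter_upwards [ae_norm_eq_one d] with u hu
  exact hC u (by simpa using hu)

/-! ### Sign flips -/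

/-- The sign attached to a Boolean. -/
def sgn (b : Bool) : ℝ := if b then 1 else -1

theorem abs_sgn (b : Bool) : |sgn b| = 1 := by cases b <;> simp [sgn]

theorem sgn_not (b : Bool) : sgn (!b) = -sgn b := by cases b <;> simp [sgn]

/-- The isometry that multiplies the coordinates by prescribed signs. -/
noncomputable def signFlip {d : ℕ} (s : Fin d → Bool) :
    EuclideanSpace ℝ (Fin d) ≃ₗᵢ[ℝ] EuclideanSpace ℝ (Fin d) :=
  LinearIsometryEquiv.piLpCongrRight 2
    (fun i => if s i then LinearIsometryEquiv.refl ℝ ℝ else LinearIsometryEquiv.neg ℝ)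

@[simp]
theorem signFlip_apply {d : ℕ} (s : Fin d → Bool) (u : EuclideanSpace ℝ (Fin d)) (i : Fin d) :
    signFlip s u i = sgn (s i) * u i := by
  cases h : s i <;> simp [signFlip, sgn, h]

theorem signFlip_not {d : ℕ} (s : Fin d → Bool) (u : EuclideanSpace ℝ (Fin d)) :
    signFlip (fun i => !s i) u = -signFlip s u := by
  ext i
  simp [sgn_not]

/-- The average of a function over the hypercube of sign patterns. -/
noncomputable def cubeMean {n : ℕ} (F : (Fin n → Bool) → ℝ) : ℝ := (∑ s, F s) / 2 ^ n

theorem integral_eq_integral_cubeMean {d : ℕ} [NeZero d] {φ : EuclideanSpace ℝ (Fin d) → ℝ}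
    (hφ : Continuous φ) :
    ∫ u, φ u ∂(uniformSphere d) =
      ∫ u, cubeMean (fun s => φ (signFlip s u)) ∂(uniformSphere d) := by
  unfold cubeMean
  have hint : ∀ s ∈ (Finset.univ : Finset (Fin d → Bool)),
      Integrable (fun u => φ (signFlip s u)) (uniformSphere d) := fun s _ =>
    integrable_uniformSphere (hφ.comp (signFlip s).continuous)
  rw [integral_div, integral_finsetSum _ hint]
  simp_rw [integral_uniformSphere_comp (signFlip _) φ]
  simp

theorem continuous_cubeMean_signFlip {d : ℕ} {φ : EuclideanSpace ℝ (Fin d) → ℝ}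
    (hφ : Continuous φ) : Continuous fun u => cubeMean (fun s => φ (signFlip s u)) :=
  (continuous_finsetSum _ fun s _ => hφ.comp (signFlip s).continuous).div_const _

theorem cubeMean_mono {n : ℕ} {F H : (Fin n → Bool) → ℝ} (h : ∀ s, F s ≤ H s) :
    cubeMean F ≤ cubeMean H := by
  unfold cubeMean
  gcongr
  exact h _

theorem cubeMean_mul_right {n : ℕ} (F : (Fin n → Bool) → ℝ) (c : ℝ) :
    cubeMean (fun s => F s * c) = cubeMean F * c := by
  unfold cubeMean
  rw [← Finset.sum_mul]
  ring

theorem cubeMean_succ {n : ℕ} (F : (Fin (n + 1) → Bool) → ℝ) :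
    cubeMean F = (cubeMean (fun s => F (Fin.cons true s)) +
      cubeMean (fun s => F (Fin.cons false s))) / 2 := by
  unfold cubeMean
  rw [← (Fin.consEquiv (fun _ : Fin (n + 1) => Bool)).sum_comp, Fintype.sum_prod_type,
    Fintype.sum_bool]
  simp only [Fin.consEquiv, Equiv.coe_fn_mk]
  rw [pow_succ]
  field_simp

theorem cubeMean_eq_zero_of_odd {n : ℕ} {F : (Fin n → Bool) → ℝ}
    (h : ∀ s, F (fun i => !s i) = -F s) : cubeMean F = 0 := by
  have e : ∑ s, F s = ∑ s : Fin n → Bool, F (fun i => !s i) :=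
    (Equiv.sum_comp (Equiv.piCongrRight fun _ : Fin n => Equiv.boolNot) F).symm
  have : ∑ s, F s = 0 := by
    simp_rw [h, Finset.sum_neg_distrib] at e
    linarith
  simp [cubeMean, this]

theorem cubeMean_sub {n : ℕ} (F H : (Fin n → Bool) → ℝ) :
    cubeMean (fun s => F s - H s) = cubeMean F - cubeMean H := by
  simp [cubeMean, Finset.sum_sub_distrib, sub_div]

theorem cubeMean_const {n : ℕ} (c : ℝ) : cubeMean (fun _ : Fin n → Bool => c) = c := by
  simp [cubeMean]

/-- The Efron–Stein inequality on the hypercube, for bounded differences. -/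
theorem cubeMean_sq_le {n : ℕ} (F : (Fin n → Bool) → ℝ) (c : Fin n → ℝ)
    (h : ∀ i s b, |F (Function.update s i b) - F s| ≤ c i) :
    cubeMean (fun s => F s ^ 2) ≤ cubeMean F ^ 2 + (∑ i, c i ^ 2) / 4 := by
  induction n with
  | zero => simp [cubeMean]
  | succ n ih =>
    rw [cubeMean_succ, cubeMean_succ F, Fin.sum_univ_succ]
    have hb : ∀ b, cubeMean (fun s => F (Fin.cons b s) ^ 2) ≤
        cubeMean (fun s => F (Fin.cons b s)) ^ 2 + (∑ i : Fin n, c i.succ ^ 2) / 4 := fun b =>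
      ih (fun s => F (Fin.cons b s)) (fun i => c i.succ) fun i s b' => by
        rw [Fin.cons_update]
        exact h i.succ _ b'
    have h0 : ∀ s : Fin n → Bool, |F (Fin.cons true s) - F (Fin.cons false s)| ≤ c 0 := fun s => by
      have := h 0 (Fin.cons false s) true
      rwa [Fin.update_cons_zero] at this
    have h1 : cubeMean (fun s => F (Fin.cons true s)) - cubeMean (fun s => F (Fin.cons false s))
        ≤ c 0 := by
      rw [← cubeMean_sub, ← cubeMean_const (n := n) (c 0)]
      exact cubeMean_mono fun s => (abs_le.1 (h0 s)).2
    have h2 : -c 0 ≤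
        cubeMean (fun s => F (Fin.cons true s)) - cubeMean (fun s => F (Fin.cons false s)) := by
      rw [← cubeMean_sub, ← cubeMean_const (n := n) (-c 0)]
      exact cubeMean_mono fun s => (abs_le.1 (h0 s)).1
    -- With `A`, `B` the two half-cube means, `(A² + B²)/2 = ((A + B)/2)² + ((A - B)/2)²`, and `|A -
    -- B| ≤ c 0`.
    nlinarith [hb true, hb false]

/-- The mean factorizes into a product of `cosh (v i)`, each at most `exp (v i ^ 2 / 2)`. -/
theorem cubeMean_exp {n : ℕ} (v : Fin n → ℝ) :
    cubeMean (fun s => Real.exp (∑ i, sgn (s i) * v i)) ≤ Real.exp ((∑ i, v i ^ 2) / 2) := by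
  induction n with
  | zero => simp [cubeMean]
  | succ n ih =>
    rw [cubeMean_succ]
    simp only [Fin.sum_univ_succ, Fin.cons_zero, Fin.cons_succ]
    simp_rw [Real.exp_add, mul_comm (Real.exp (sgn _ * _)), cubeMean_mul_right]
    rw [add_div (v 0 ^ 2), Real.exp_add]
    have := Real.cosh_le_exp_half_sq (v 0)
    rw [Real.cosh_eq] at this
    calc _ = cubeMean (fun s => Real.exp (∑ i : Fin n, sgn (s i) * v i.succ)) *
          ((Real.exp (v 0) + Real.exp (-v 0)) / 2) := by simp only [sgn]; simp; ring
      _ ≤ Real.exp ((∑ i : Fin n, v i.succ ^ 2) / 2) * Real.exp (v 0 ^ 2 / 2) := by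
          gcongr
          exact ih _
      _ = _ := mul_comm _ _

/-! ### Moments on the sphere -/

theorem sum_sq_eq_norm_sq {d : ℕ} (u : EuclideanSpace ℝ (Fin d)) : ∑ i, u i ^ 2 = ‖u‖ ^ 2 :=
  (EuclideanSpace.real_norm_sq_eq u).symm

/-- One-dimensional marginals in directions of equal length have the same law. -/
theorem integral_comp_inner_eq {d : ℕ} {v v' : EuclideanSpace ℝ (Fin d)} (h : ‖v‖ = ‖v'‖)
    (g : ℝ → ℝ) :
    ∫ u, g (inner ℝ v u) ∂(uniformSphere d) = ∫ u, g (inner ℝ v' u) ∂(uniformSphere d) := by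
  -- Reflection in the hyperplane orthogonal to `v - v'` carries `v` to `v'`.
  have hL := Submodule.reflection_sub h
  rw [← integral_uniformSphere_comp (ℝ ∙ (v - v'))ᗮ.reflection (fun u => g (inner ℝ v' u))]
  refine integral_congr_ae (Filter.Eventually.of_forall fun u => ?_)
  have := (ℝ ∙ (v - v'))ᗮ.reflection.inner_map_map v u
  rw [hL] at this
  simp only [this]

/-- By rotation invariance the coordinates share one second moment, and their squares sum to 1. -/
theorem integral_inner_sq {d : ℕ} [NeZero d] (v : EuclideanSpace ℝ (Fin d)) :
    (d : ℝ) * ∫ u, inner ℝ v u ^ 2 ∂(uniformSphere d) = ‖v‖ ^ 2 := by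
  have h : ∀ i : Fin d, ∫ u, inner ℝ v u ^ 2 ∂(uniformSphere d) =
      ‖v‖ ^ 2 * ∫ u, u i ^ 2 ∂(uniformSphere d) := fun i => by
    rw [integral_comp_inner_eq (v' := ‖v‖ • EuclideanSpace.single i (1 : ℝ))
      (by simp [norm_smul]) (fun x => x ^ 2), ← integral_const_mul]
    simp [inner_smul_left, mul_pow, EuclideanSpace.inner_single_left]
  have hint : ∀ i ∈ (Finset.univ : Finset (Fin d)),
      Integrable (fun u : EuclideanSpace ℝ (Fin d) => u i ^ 2) (uniformSphere d) := fun i _ =>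
    integrable_uniformSphere (by fun_prop)
  calc _ = ∑ i : Fin d, ∫ u, inner ℝ v u ^ 2 ∂(uniformSphere d) := by simp
    _ = ‖v‖ ^ 2 * ∫ u, ∑ i : Fin d, u i ^ 2 ∂(uniformSphere d) := by
        rw [integral_finsetSum _ hint, Finset.mul_sum]
        exact Finset.sum_congr rfl fun i _ => h i
    _ = ‖v‖ ^ 2 * ∫ u, 1 ∂(uniformSphere d) := by
        congr 1
        refine integral_congr_ae ?_
        filter_upwards [ae_norm_eq_one d] with u hu
        rw [sum_sq_eq_norm_sq, hu, one_pow]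
    _ = _ := by simp

/-- The coordinates of a uniform point of the sphere are sub-Gaussian at scale `1 / √d`. -/
theorem integral_exp_coord_le {d : ℕ} [NeZero d] (a : ℝ) (i : Fin d) :
    ∫ u, Real.exp (a * Real.sqrt d * u i) ∂(uniformSphere d) ≤ Real.exp (a ^ 2 / 2) := by
  have hd : (0 : ℝ) < d := Nat.cast_pos.2 (NeZero.pos d)
  -- The constant vector has the same length as `a √d` times a basis vector, and in its direction
  -- the sign average is bounded by `exp (a² ‖u‖² / 2)`.
  set v : EuclideanSpace ℝ (Fin d) := WithLp.toLp 2 (fun _ => a)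
  have hv : ‖EuclideanSpace.single i (a * Real.sqrt d)‖ = ‖v‖ := by
    rw [PiLp.norm_single, ← sq_eq_sq₀ (norm_nonneg _) (norm_nonneg _),
      ← sum_sq_eq_norm_sq, Real.norm_eq_abs, sq_abs, mul_pow, Real.sq_sqrt hd.le]
    simp [v, mul_comm]
  have hc : Continuous fun u => Real.exp (inner ℝ v u) := by fun_prop
  calc _ = ∫ u, Real.exp (inner ℝ (EuclideanSpace.single i (a * Real.sqrt d)) u)
        ∂(uniformSphere d) := by simp [EuclideanSpace.inner_single_left]
    _ = ∫ u, Real.exp (inner ℝ v u) ∂(uniformSphere d) := integral_comp_inner_eq hv Real.exp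
    _ = _ := integral_eq_integral_cubeMean hc
    _ ≤ ∫ u, Real.exp (a ^ 2 / 2) ∂(uniformSphere d) := by
        refine integral_mono_ae (integrable_uniformSphere (continuous_cubeMean_signFlip hc))
          (integrable_const _) ?_
        filter_upwards [ae_norm_eq_one d] with u hu
        have := cubeMean_exp (fun i => a * u i)
        simp_rw [mul_pow, ← Finset.mul_sum, sum_sq_eq_norm_sq, hu, one_pow, mul_one] at this
        refine le_of_eq_of_le ?_ this
        congr 1
        ext s
        simp only [v, PiLp.inner_apply, signFlip_apply]
        congr 1
        exact Finset.sum_congr rfl fun i _ => by simp; ring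
    _ = _ := by simp

/-- The supremum norm of the coordinates. -/
noncomputable def supNorm {d : ℕ} (u : EuclideanSpace ℝ (Fin d)) : ℝ := ‖(WithLp.ofLp u : Fin d → ℝ)‖

theorem supNorm_nonneg {d : ℕ} (u : EuclideanSpace ℝ (Fin d)) : 0 ≤ supNorm u := norm_nonneg _

theorem abs_apply_le_supNorm {d : ℕ} (u : EuclideanSpace ℝ (Fin d)) (i : Fin d) :
    |u i| ≤ supNorm u := norm_le_pi_norm (WithLp.ofLp u) i

theorem continuous_supNorm {d : ℕ} : Continuous (supNorm : EuclideanSpace ℝ (Fin d) → ℝ) :=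
  (PiLp.continuous_ofLp 2 _).norm

theorem supNorm_signFlip {d : ℕ} (s : Fin d → Bool) (u : EuclideanSpace ℝ (Fin d)) :
    supNorm (signFlip s u) = supNorm u := by
  simp [supNorm, Pi.norm_def, nnnorm_mul, ← Real.nnnorm_abs (sgn _), abs_sgn]

theorem supNorm_smul {d : ℕ} (c : ℝ) (u : EuclideanSpace ℝ (Fin d)) :
    supNorm (c • u) = |c| * supNorm u := by
  simp [supNorm, norm_smul]

theorem supNormFourthMoment_nonneg (d : ℕ) : 0 ≤ supNormFourthMoment d := by
  unfold supNormFourthMoment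
  positivity

theorem supNormFourthMoment_pow (d : ℕ) :
    supNormFourthMoment d ^ 4 = ∫ u, supNorm u ^ 4 ∂(uniformSphere d) := by
  unfold supNormFourthMoment
  rw [← Real.rpow_natCast, ← Real.rpow_mul (integral_nonneg fun u => by positivity)]
  norm_num [supNorm]

/-- The variance of `supNorm u ^ 2` is nonnegative. -/
theorem integral_supNorm_sq_le {d : ℕ} [NeZero d] :
    ∫ u, supNorm u ^ 2 ∂(uniformSphere d) ≤ supNormFourthMoment d ^ 2 := by
  have hc := continuous_supNorm (d := d)
  have hm := supNormFourthMoment_pow d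
  set m := ∫ u, supNorm u ^ 2 ∂(uniformSphere d)
  have h : 0 ≤ ∫ u, (supNorm u ^ 2 - m) ^ 2 ∂(uniformSphere d) :=
    integral_nonneg fun u => sq_nonneg _
  have e : ∫ u, (supNorm u ^ 2 - m) ^ 2 ∂(uniformSphere d) =
      ∫ u, supNorm u ^ 4 ∂(uniformSphere d) - m ^ 2 := by
    have : ∀ u : EuclideanSpace ℝ (Fin d),
        (supNorm u ^ 2 - m) ^ 2 = supNorm u ^ 4 - 2 * m * supNorm u ^ 2 + m ^ 2 := fun u => by ring
    simp_rw [this]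
    rw [integral_add (integrable_uniformSphere (by fun_prop)) (integrable_const _),
      integral_sub (integrable_uniformSphere (by fun_prop)) (integrable_uniformSphere (by fun_prop)),
      integral_const_mul]
    simp
    ring
  rw [e, ← hm] at h
  refine le_of_sq_le_sq ?_ (by positivity)
  linarith

/-- Above `a`, combine `(a + z)^4 ≤ 8 (a^4 + z^4)` with `z^4 ≤ 4! / l^4 * exp (l z)`; hence `192 = 8
* 4!`. -/
theorem pow_four_le_exp {y a l : ℝ} (hy : 0 ≤ y) (ha : 0 ≤ a) (hl : 0 < l) :
    y ^ 4 ≤ 8 * a ^ 4 + 192 / l ^ 4 * Real.exp (l * (y - a)) := by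
  rcases le_total y a with h | h
  · have : y ^ 4 ≤ a ^ 4 := by gcongr
    have : 0 ≤ 192 / l ^ 4 * Real.exp (l * (y - a)) := by positivity
    have : 0 ≤ a ^ 4 := by positivity
    linarith
  · have h1 := Real.pow_div_factorial_le_exp (l * (y - a)) (by nlinarith) 4
    have h2 : 192 / l ^ 4 * ((l * (y - a)) ^ 4 / (Nat.factorial 4 : ℕ)) = 8 * (y - a) ^ 4 := by
      norm_num [Nat.factorial]
      field_simp
      ring
    have h3 : y ^ 4 ≤ 8 * (a ^ 4 + (y - a) ^ 4) := by
      have := add_pow_le ha (sub_nonneg.2 h) 4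
      norm_num at this
      simpa using this
    have h4 : 192 / l ^ 4 * ((l * (y - a)) ^ 4 / (Nat.factorial 4 : ℕ)) ≤
        192 / l ^ 4 * Real.exp (l * (y - a)) := by gcongr
    linarith

theorem exp_supNorm_le {d : ℕ} [NeZero d] (b : ℝ) (u : EuclideanSpace ℝ (Fin d)) :
    Real.exp (b * supNorm u) ≤ ∑ i, (Real.exp (b * u i) + Real.exp (-b * u i)) := by
  obtain ⟨i, hi⟩ : ∃ i, supNorm u = |u i| := by
    obtain ⟨i, -, hi⟩ := Finset.exists_max_image Finset.univ (fun i => |u i|) Finset.univ_nonempty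
    refine ⟨i, le_antisymm ?_ (abs_apply_le_supNorm u i)⟩
    exact (pi_norm_le_iff_of_nonneg (abs_nonneg _)).2 fun j => hi j (Finset.mem_univ j)
  refine le_trans ?_ (Finset.single_le_sum (f := fun i => Real.exp (b * u i) + Real.exp (-b * u i))
    (fun i _ => by positivity) (Finset.mem_univ i))
  rw [hi]
  rcases abs_choice (u i) with h | h <;> rw [h]
  · linarith [Real.exp_pos (-b * u i)]
  · rw [mul_neg, ← neg_mul]
    linarith [Real.exp_pos (b * u i)]

theorem integral_exp_supNorm_le {d : ℕ} [NeZero d] (l : ℝ) :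
    ∫ u, Real.exp (l * Real.sqrt d * supNorm u) ∂(uniformSphere d) ≤
      2 * d * Real.exp (l ^ 2 / 2) := by
  have hc := continuous_supNorm (d := d)
  have hi : ∀ (b : ℝ) (i : Fin d), Integrable
      (fun u : EuclideanSpace ℝ (Fin d) => Real.exp (b * u i)) (uniformSphere d) := fun b i =>
    integrable_uniformSphere (by fun_prop)
  calc _ ≤ ∫ u, ∑ i : Fin d, (Real.exp (l * Real.sqrt d * u i) +
        Real.exp (-(l * Real.sqrt d) * u i)) ∂(uniformSphere d) :=
        integral_mono (integrable_uniformSphere (by fun_prop))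
          (integrable_finsetSum _ fun i _ => (hi _ i).add (hi _ i))
          fun u => exp_supNorm_le _ u
    _ = ∑ i : Fin d, ((∫ u, Real.exp (l * Real.sqrt d * u i) ∂(uniformSphere d)) +
        ∫ u, Real.exp (-(l * Real.sqrt d) * u i) ∂(uniformSphere d)) := by
        have hs : ∀ i ∈ (Finset.univ : Finset (Fin d)), Integrable
            (fun u : EuclideanSpace ℝ (Fin d) => Real.exp (l * Real.sqrt d * u i) +
              Real.exp (-(l * Real.sqrt d) * u i)) (uniformSphere d) :=
          fun i _ => (hi _ i).add (hi _ i)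
        rw [integral_finsetSum _ hs]
        exact Finset.sum_congr rfl fun i _ => integral_add (hi _ i) (hi _ i)
    _ ≤ ∑ i : Fin d, (Real.exp (l ^ 2 / 2) + Real.exp (l ^ 2 / 2)) := by
        gcongr with i
        · exact integral_exp_coord_le l i
        · have := integral_exp_coord_le (-l) i
          rwa [neg_sq, neg_mul] at this
    _ = _ := by simp; ring

theorem supNormFourthMoment_le : ∃ c₀ : ℝ, 0 < c₀ ∧ ∀ d : ℕ, 2 ≤ d →
    supNormFourthMoment d ≤ c₀ * Real.sqrt (Real.log d / d) := by
  have hl2 : 0 < Real.log 2 := Real.log_pos one_lt_two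
  set K := 128 + 384 / Real.log 2 ^ 4 with hK
  have hK1 : 1 ≤ K := by
    have : 0 ≤ 384 / Real.log 2 ^ 4 := by positivity
    linarith
  refine ⟨K, by linarith, fun d hd => ?_⟩
  have : NeZero d := ⟨by lia⟩
  have hd2 : (2 : ℝ) ≤ d := by exact_mod_cast hd
  have hd0 : (0 : ℝ) < d := by linarith
  have hL2 : Real.log 2 ≤ Real.log d := Real.log_le_log two_pos hd2
  have hL : 0 < Real.log d := hl2.trans_le hL2
  set L := Real.log d
  set l := Real.sqrt L
  have hl : 0 < l := Real.sqrt_pos.2 hL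
  have hll : l ^ 2 = L := Real.sq_sqrt hL.le
  have hc := continuous_supNorm (d := d)
  -- The threshold `2 l` with `l = √(log d)` is large enough for the factor `exp (-2 log d)` to
  -- absorb the `2 d` terms of the union bound.
  have key : (d : ℝ) ^ 2 * supNormFourthMoment d ^ 4 ≤
      8 * (2 * l) ^ 4 + 192 / l ^ 4 * (Real.exp (-(2 * L)) * (2 * d * Real.exp (l ^ 2 / 2))) := by
    rw [supNormFourthMoment_pow, ← integral_const_mul]
    calc _ ≤ ∫ u, (8 * (2 * l) ^ 4 + 192 / l ^ 4 * (Real.exp (-(2 * L)) *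
          Real.exp (l * Real.sqrt d * supNorm u))) ∂(uniformSphere d) := by
          refine integral_mono (integrable_uniformSphere (by fun_prop))
            (integrable_uniformSphere (by fun_prop)) fun u => ?_
          have := pow_four_le_exp (mul_nonneg (Real.sqrt_nonneg d) (supNorm_nonneg u))
            (by positivity : 0 ≤ 2 * l) hl
          rw [mul_pow, show Real.sqrt d ^ 4 = (Real.sqrt d ^ 2) ^ 2 by ring, Real.sq_sqrt hd0.le,
            show l * (Real.sqrt d * supNorm u - 2 * l) = -(2 * l ^ 2) + l * Real.sqrt d * supNorm u
              by ring, hll, Real.exp_add] at this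
          exact this
      _ ≤ _ := by
          rw [integral_add (integrable_const _) (integrable_uniformSphere (by fun_prop)),
            integral_const_mul, integral_const_mul]
          have := integral_exp_supNorm_le (d := d) l
          simp only [integral_const, probReal_univ, one_smul, integral_const_mul]
          gcongr
  have hexp : Real.exp (-(2 * L)) * (2 * d * Real.exp (l ^ 2 / 2)) ≤ 2 := by
    have h1 : (d : ℝ) = Real.exp L := (Real.exp_log hd0).symm
    rw [hll, h1, show Real.exp (-(2 * L)) * (2 * Real.exp L * Real.exp (L / 2)) =
      2 * (Real.exp (-(2 * L)) * Real.exp L * Real.exp (L / 2)) by ring, ← Real.exp_add,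
      ← Real.exp_add]
    have : Real.exp (-(2 * L) + L + L / 2) ≤ 1 := Real.exp_le_one_iff.2 (by linarith)
    linarith
  have hb : (d : ℝ) ^ 2 * supNormFourthMoment d ^ 4 ≤ K * L ^ 2 := by
    have h4 : l ^ 4 = L ^ 2 := by rw [← hll]; ring
    have h5 : 384 / L ^ 2 ≤ 384 / Real.log 2 ^ 4 * L ^ 2 := by
      rw [div_mul_eq_mul_div, div_le_div_iff₀ (by positivity) (by positivity)]
      have : Real.log 2 ^ 4 ≤ L ^ 4 := by gcongr
      nlinarith
    calc _ ≤ 8 * (2 * l) ^ 4 + 192 / l ^ 4 * 2 := key.trans (by gcongr)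
      _ = 128 * L ^ 2 + 384 / L ^ 2 := by rw [mul_pow, h4]; ring
      _ ≤ _ := by rw [hK]; linarith
  refine le_of_pow_le_pow_left₀ (n := 4) (by norm_num) (by positivity) ?_
  rw [mul_pow, show Real.sqrt (L / d) ^ 4 = (Real.sqrt (L / d) ^ 2) ^ 2 by ring,
    Real.sq_sqrt (by positivity), div_pow, mul_div_assoc', le_div_iff₀ (by positivity), mul_comm]
  refine hb.trans ?_
  gcongr
  -- As `1 ≤ K`, the constant `K` itself can stand in for its fourth root.
  exact le_self_pow₀ hK1 (by norm_num)

/-! ### The gradient estimate for a fixed loss -/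

theorem IsLipschitzL1.continuous {d : ℕ} {G : ℝ} {f : EuclideanSpace ℝ (Fin d) → ℝ}
    (hf : IsLipschitzL1 G f) : Continuous f := by
  refine continuous_iff_continuousAt.2 fun x => tendsto_iff_norm_sub_tendsto_zero.2 ?_
  refine squeeze_zero (fun _ => norm_nonneg _) (fun y => hf y x) ?_
  have : Continuous fun y : EuclideanSpace ℝ (Fin d) => G * ∑ i, |y i - x i| := by fun_prop
  simpa using this.tendsto x

theorem sum_abs_le {d : ℕ} (u : EuclideanSpace ℝ (Fin d)) :
    ∑ i, |u i| ≤ Real.sqrt d * ‖u‖ := by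
  have h := sq_sum_le_card_mul_sum_sq (s := Finset.univ) (f := fun i => |u i|)
  simp only [sq_abs, sum_sq_eq_norm_sq, Finset.card_univ, Fintype.card_fin] at h
  refine le_of_sq_le_sq ?_ (by positivity)
  rwa [mul_pow, Real.sq_sqrt (Nat.cast_nonneg d)]

theorem IsLipschitzL1.abs_add_sub_le {d : ℕ} {G : ℝ} {f : EuclideanSpace ℝ (Fin d) → ℝ}
    (hf : IsLipschitzL1 G f) (hG : 0 ≤ G) (x u : EuclideanSpace ℝ (Fin d)) {δ : ℝ} (hδ : 0 ≤ δ)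
    (hu : ‖u‖ = 1) : |f (x + δ • u) - f x| ≤ δ * G * Real.sqrt d := by
  refine (hf _ _).trans ?_
  have : ∑ i, |(x + δ • u) i - x i| = δ * ∑ i, |u i| := by
    simp [abs_mul, Finset.mul_sum, abs_of_nonneg hδ]
  rw [this]
  have := sum_abs_le u
  rw [hu, mul_one] at this
  calc G * (δ * ∑ i, |u i|) ≤ G * (δ * Real.sqrt d) := by gcongr
    _ = _ := by ring

theorem IsLipschitzL1.abs_symmDiff_le {d : ℕ} {G : ℝ} {f : EuclideanSpace ℝ (Fin d) → ℝ}
    (hf : IsLipschitzL1 G f) (hG : 0 ≤ G) (x u : EuclideanSpace ℝ (Fin d)) {δ : ℝ} (hδ : 0 ≤ δ)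
    (hu : ‖u‖ = 1) : |f (x + δ • u) - f (x - δ • u)| ≤ 2 * (δ * G * Real.sqrt d) := by
  have h1 := hf.abs_add_sub_le hG x u hδ hu
  have h2 := hf.abs_add_sub_le hG x (-u) hδ (by rwa [norm_neg])
  rw [smul_neg, ← sub_eq_add_neg] at h2
  rw [abs_le] at *
  constructor <;> linarith

theorem cubeMean_symmDiff_sq_le {d : ℕ} {G : ℝ} {f : EuclideanSpace ℝ (Fin d) → ℝ}
    (hf : IsLipschitzL1 G f) (x u : EuclideanSpace ℝ (Fin d)) (δ : ℝ) :
    cubeMean (fun s => (f (x + δ • signFlip s u) - f (x - δ • signFlip s u)) ^ 2) ≤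
      4 * G ^ 2 * δ ^ 2 * ‖u‖ ^ 2 := by
  have key := cubeMean_sq_le (fun s => f (x + δ • signFlip s u) - f (x - δ • signFlip s u))
    -- A flip moves coordinate `i` of each query point by at most `2 |δ| |u i|`, and there are two
    -- query points.
    (fun i => 4 * G * |δ| * |u i|) fun i s b => by
      have hu : ∀ j, |signFlip (Function.update s i b) u j - signFlip s u j| ≤
          if j = i then 2 * |u i| else 0 := fun j => by
        rw [signFlip_apply, signFlip_apply, ← sub_mul, abs_mul]
        by_cases hj : j = i
        · subst hj
          have : |sgn b - sgn (s j)| ≤ 2 :=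
            (abs_sub _ _).trans (by rw [abs_sgn, abs_sgn]; norm_num)
          simp only [Function.update_self, if_true]
          gcongr
        · simp [hj]
      have hG : 0 ≤ G ∨ d = 0 := by
        rcases Nat.eq_zero_or_pos d with h | h
        · exact Or.inr h
        · left
          have := (abs_nonneg _).trans (hf (EuclideanSpace.single ⟨0, h⟩ 1) 0)
          simpa [PiLp.single_apply, apply_ite abs] using this
      have hG : 0 ≤ G := hG.resolve_right (by have := i.pos; lia)
      have hsum : ∑ j, |signFlip (Function.update s i b) u j - signFlip s u j| ≤ 2 * |u i| :=
        (Finset.sum_le_sum fun j _ => hu j).trans (by simp)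
      have h1 := hf (x + δ • signFlip (Function.update s i b) u) (x + δ • signFlip s u)
      have h2 := hf (x - δ • signFlip (Function.update s i b) u) (x - δ • signFlip s u)
      have e1 : ∑ j, |(x + δ • signFlip (Function.update s i b) u) j - (x + δ • signFlip s u) j| =
          |δ| * ∑ j, |signFlip (Function.update s i b) u j - signFlip s u j| := by
        rw [Finset.mul_sum]
        refine Finset.sum_congr rfl fun j _ => ?_
        rw [← abs_mul]
        simp only [PiLp.add_apply, PiLp.smul_apply, smul_eq_mul]
        congr 1
        ring
      have e2 : ∑ j, |(x - δ • signFlip (Function.update s i b) u) j - (x - δ • signFlip s u) j| =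
          |δ| * ∑ j, |signFlip (Function.update s i b) u j - signFlip s u j| := by
        rw [Finset.mul_sum]
        refine Finset.sum_congr rfl fun j _ => ?_
        rw [← abs_mul, abs_sub_comm]
        simp only [PiLp.sub_apply, PiLp.smul_apply, smul_eq_mul]
        congr 1
        ring
      rw [e1] at h1
      rw [e2] at h2
      have h3 : G * (|δ| * ∑ j, |signFlip (Function.update s i b) u j - signFlip s u j|) ≤
          G * (|δ| * (2 * |u i|)) := by gcongr
      rw [abs_le] at *
      constructor <;> linarith
  rw [cubeMean_eq_zero_of_odd
    (F := fun s => f (x + δ • signFlip s u) - f (x - δ • signFlip s u)) fun s => by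
      rw [signFlip_not, smul_neg, sub_neg_eq_add, ← sub_eq_add_neg, neg_sub]] at key
  refine key.trans (le_of_eq ?_)
  simp_rw [mul_pow, sq_abs, ← Finset.mul_sum, sum_sq_eq_norm_sq]
  ring

theorem supNorm_gradEstimate_sq {d : ℕ} (δ : ℝ) (f : EuclideanSpace ℝ (Fin d) → ℝ)
    (x u : EuclideanSpace ℝ (Fin d)) :
    supNorm (gradEstimate δ f x u) ^ 2 =
      (d / (2 * δ)) ^ 2 * ((f (x + δ • u) - f (x - δ • u)) ^ 2 * supNorm u ^ 2) := by
  rw [gradEstimate, supNorm_smul, mul_pow, sq_abs]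
  ring

/-- The second moment of the gradient estimate in the supremum norm. -/
theorem integral_supNorm_gradEstimate_sq_le {d : ℕ} [NeZero d] {G δ : ℝ}
    {f : EuclideanSpace ℝ (Fin d) → ℝ} (hf : IsLipschitzL1 G f) (hδ : 0 < δ)
    (x : EuclideanSpace ℝ (Fin d)) :
    ∫ u, supNorm (gradEstimate δ f x u) ^ 2 ∂(uniformSphere d) ≤
      d ^ 2 * G ^ 2 * supNormFourthMoment d ^ 2 := by
  have hfc := hf.continuous
  have hsc := continuous_supNorm (d := d)
  have hc : Continuous fun u => (f (x + δ • u) - f (x - δ • u)) ^ 2 * supNorm u ^ 2 := by fun_prop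
  have h : ∫ u, (f (x + δ • u) - f (x - δ • u)) ^ 2 * supNorm u ^ 2 ∂(uniformSphere d) ≤
      4 * G ^ 2 * δ ^ 2 * supNormFourthMoment d ^ 2 := by
    rw [integral_eq_integral_cubeMean hc]
    calc _ ≤ ∫ u, 4 * G ^ 2 * δ ^ 2 * supNorm u ^ 2 ∂(uniformSphere d) := by
          refine integral_mono_ae (integrable_uniformSphere (continuous_cubeMean_signFlip hc))
            (integrable_uniformSphere (by fun_prop)) ?_
          filter_upwards [ae_norm_eq_one d] with u hu
          simp_rw [supNorm_signFlip, cubeMean_mul_right]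
          have := cubeMean_symmDiff_sq_le hf x u δ
          rw [hu, one_pow, mul_one] at this
          gcongr
      _ ≤ _ := by
          rw [integral_const_mul]
          gcongr
          exact integral_supNorm_sq_le
  simp_rw [supNorm_gradEstimate_sq]
  rw [integral_const_mul]
  calc _ ≤ (d / (2 * δ)) ^ 2 * (4 * G ^ 2 * δ ^ 2 * supNormFourthMoment d ^ 2) := by gcongr
    _ = _ := by
      field_simp
      ring

/-- Slopes increase along a line: `z` is the mixture of `z - a` and `z + t • a` with weights `t / (1
+ t)` and `1 / (1 + t)`. -/
theorem convexOn_mul_sub_le_sub {E : Type*} [AddCommGroup E] [Module ℝ E] {h : E → ℝ}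
    (hh : ConvexOn ℝ Set.univ h) (z a : E) {t : ℝ} (ht : 0 ≤ t) :
    t * (h z - h (z - a)) ≤ h (z + t • a) - h z := by
  have h1 : 0 < 1 + t := by linarith
  have := hh.2 (Set.mem_univ (z - a)) (Set.mem_univ (z + t • a))
    (div_nonneg ht h1.le) (div_nonneg zero_le_one h1.le) (by field_simp; ring)
  have e : (t / (1 + t)) • (z - a) + (1 / (1 + t)) • (z + t • a) = z := by
    match_scalars <;> field_simp <;> ring
  rw [e, smul_eq_mul, smul_eq_mul, div_mul_eq_mul_div, div_mul_eq_mul_div, ← add_div,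
    le_div_iff₀ h1] at this
  linarith

/-- The gradient estimate is a subgradient on average, up to an error of order `δ`. -/
theorem sub_le_integral_inner_gradEstimate {d : ℕ} [NeZero d] {G δ : ℝ}
    {f : EuclideanSpace ℝ (Fin d) → ℝ} (hconv : ConvexOn ℝ Set.univ f) (hf : IsLipschitzL1 G f)
    (hG : 0 ≤ G) (hδ : 0 < δ) (x y : EuclideanSpace ℝ (Fin d)) :
    f x - f y ≤ ∫ u, inner ℝ (gradEstimate δ f x u) (x - y) ∂(uniformSphere d) +
      2 * (δ * G * Real.sqrt d) := by
  have hfc := hf.continuous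
  have hd : (0 : ℝ) < d := Nat.cast_pos.2 (NeZero.pos d)
  rcases eq_or_ne x y with rfl | hxy
  · simp only [sub_self, inner_zero_right, integral_zero, zero_add]
    positivity
  set a := x - y with ha
  have ha0 : 0 < ‖a‖ ^ 2 := by
    have := norm_pos_iff.2 (sub_ne_zero.2 hxy)
    positivity
  set D := f x - f y - 2 * (δ * G * Real.sqrt d) with hD
  set ρ := (ℝ ∙ a)ᗮ.reflection with hρ
  have hρa : ρ a = -a := Submodule.reflection_orthogonalComplement_singleton_eq_neg a
  have hinner : ∀ u, inner ℝ a (ρ u) = -inner ℝ a u := fun u => by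
    have := ρ.inner_map_map a u
    rw [hρa, inner_neg_left] at this
    linarith
  have hρu : ∀ u, ρ u = u - (2 * inner ℝ a u / ‖a‖ ^ 2) • a := fun u => by
    rw [hρ, Submodule.reflection_orthogonal_apply, Submodule.reflection_singleton_apply]
    simp only [RCLike.ofReal_real_eq_id, id]
    rw [two_nsmul]
    module
  -- `D` bounds the slope along `a` from below: stepping back by `a` from `x + δ u` lands on `y + δ
  -- u`, and removing the two perturbations costs `δ G √d` each.
  have hslope : ∀ u : EuclideanSpace ℝ (Fin d), ‖u‖ = 1 → ∀ t, 0 ≤ t →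
      t * D ≤ f (x + δ • u + t • a) - f (x + δ • u) := fun u hu t ht => by
    refine le_trans ?_ (convexOn_mul_sub_le_sub hconv (x + δ • u) a ht)
    have h1 := (abs_le.1 (hf.abs_add_sub_le hG x u hδ.le hu)).1
    have h2 := (abs_le.1 (hf.abs_add_sub_le hG y u hδ.le hu)).2
    have e : x + δ • u - a = y + δ • u := by rw [ha]; abel
    rw [e]
    gcongr
    linarith
  have hpoint : ∀ u : EuclideanSpace ℝ (Fin d), ‖u‖ = 1 →
      2 * δ / ‖a‖ ^ 2 * D * inner ℝ a u ^ 2 ≤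
        f (x + δ • u) * inner ℝ a u + f (x + δ • ρ u) * inner ℝ a (ρ u) := fun u hu => by
    rw [hinner]
    -- The sign of `⟨a, u⟩` decides which of `u`, `ρ u` is the starting point, so that the move
    -- along `a` is forward.
    rcases le_total 0 (inner ℝ a u : ℝ) with hs | hs
    · have := hslope (ρ u) (by rw [ρ.norm_map, hu]) (2 * δ / ‖a‖ ^ 2 * inner ℝ a u) (by positivity)
      have e : x + δ • ρ u + (2 * δ / ‖a‖ ^ 2 * inner ℝ a u) • a = x + δ • u := by
        rw [hρu]
        match_scalars <;> ring
      rw [e] at this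
      nlinarith [mul_le_mul_of_nonneg_right this hs]
    · have hs' : 0 ≤ -(inner ℝ a u : ℝ) := by linarith
      have := hslope u hu (2 * δ / ‖a‖ ^ 2 * -inner ℝ a u) (by positivity)
      have e : x + δ • u + (2 * δ / ‖a‖ ^ 2 * -inner ℝ a u) • a = x + δ • ρ u := by
        rw [hρu]
        match_scalars <;> ring
      rw [e] at this
      nlinarith [mul_le_mul_of_nonneg_right this hs']
  set Q : EuclideanSpace ℝ (Fin d) → ℝ := fun u => f (x + δ • u) * inner ℝ a u with hQ
  have hQc : Continuous Q := by fun_prop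
  have hQi : Integrable Q (uniformSphere d) := integrable_uniformSphere hQc
  have h1 : 2 * δ / ‖a‖ ^ 2 * D * ∫ u, inner ℝ a u ^ 2 ∂(uniformSphere d) ≤
      2 * ∫ u, Q u ∂(uniformSphere d) := by
    have hQρ : Integrable (fun u => Q (ρ u)) (uniformSphere d) :=
      integrable_uniformSphere (hQc.comp ρ.continuous)
    calc _ = ∫ u, 2 * δ / ‖a‖ ^ 2 * D * inner ℝ a u ^ 2 ∂(uniformSphere d) :=
          (integral_const_mul _ _).symm
      _ ≤ ∫ u, (Q u + Q (ρ u)) ∂(uniformSphere d) := by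
          refine integral_mono_ae (integrable_uniformSphere (by fun_prop)) (hQi.add hQρ) ?_
          filter_upwards [ae_norm_eq_one d] with u hu
          exact hpoint u hu
      _ = _ := by
          rw [integral_add hQi hQρ, integral_uniformSphere_comp ρ Q]
          ring
  -- Antipodal symmetry makes the two queries contribute equally.
  have h2 : ∫ u, inner ℝ (gradEstimate δ f x u) a ∂(uniformSphere d) =
      d / (2 * δ) * (2 * ∫ u, Q u ∂(uniformSphere d)) := by
    have hQn : Integrable (fun u => Q (-u)) (uniformSphere d) :=
      integrable_uniformSphere (hQc.comp continuous_neg)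
    have e : ∀ u, inner ℝ (gradEstimate δ f x u) a = d / (2 * δ) * (Q u + Q (-u)) := fun u => by
      rw [gradEstimate, real_inner_smul_left, real_inner_comm]
      simp only [hQ, inner_neg_right, smul_neg, ← sub_eq_add_neg]
      ring
    have hn := integral_uniformSphere_comp (LinearIsometryEquiv.neg ℝ) Q
    simp only [LinearIsometryEquiv.coe_neg] at hn
    simp_rw [e]
    rw [integral_const_mul, integral_add hQi hQn, hn]
    ring
  have h3 := integral_inner_sq a
  have h4 : D ≤ ∫ u, inner ℝ (gradEstimate δ f x u) a ∂(uniformSphere d) := by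
    rw [h2]
    calc D = d / (2 * δ) * (2 * δ / ‖a‖ ^ 2 * D * ∫ u, inner ℝ a u ^ 2 ∂(uniformSphere d)) := by
          rw [show d / (2 * δ) * (2 * δ / ‖a‖ ^ 2 * D *
            ∫ u, inner ℝ a u ^ 2 ∂(uniformSphere d)) =
            D * (d * ∫ u, inner ℝ a u ^ 2 ∂(uniformSphere d)) / ‖a‖ ^ 2 by field_simp, h3]
          exact (mul_div_cancel_right₀ D ha0.ne').symm
      _ ≤ _ := by gcongr
  linarith

/-! ### Exponential weights -/

/-- The partition function of exponential weights. -/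
noncomputable def partition {d : ℕ} (θ : EuclideanSpace ℝ (Fin d)) : ℝ := ∑ i, Real.exp (θ i)

/-- The exponential-weights distribution. -/
noncomputable def softmax {d : ℕ} (θ : EuclideanSpace ℝ (Fin d)) : EuclideanSpace ℝ (Fin d) :=
  WithLp.toLp 2 fun i => Real.exp (θ i) / partition θ

theorem partition_pos {d : ℕ} [NeZero d] (θ : EuclideanSpace ℝ (Fin d)) : 0 < partition θ :=
  Finset.sum_pos (fun _ _ => Real.exp_pos _) Finset.univ_nonempty

theorem softmax_apply {d : ℕ} (θ : EuclideanSpace ℝ (Fin d)) (i : Fin d) :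
    softmax θ i = Real.exp (θ i) / partition θ := rfl

theorem softmax_pos {d : ℕ} [NeZero d] (θ : EuclideanSpace ℝ (Fin d)) (i : Fin d) :
    0 < softmax θ i := div_pos (Real.exp_pos _) (partition_pos θ)

theorem sum_softmax {d : ℕ} [NeZero d] (θ : EuclideanSpace ℝ (Fin d)) : ∑ i, softmax θ i = 1 := by
  simp_rw [softmax_apply, ← Finset.sum_div]
  exact div_self (partition_pos θ).ne'

theorem softmax_mem_simplex {d : ℕ} [NeZero d] (θ : EuclideanSpace ℝ (Fin d)) :
    softmax θ ∈ simplex d :=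
  ⟨fun i => (softmax_pos θ i).le, sum_softmax θ⟩

theorem continuous_softmax {d : ℕ} [NeZero d] :
    Continuous (softmax : EuclideanSpace ℝ (Fin d) → EuclideanSpace ℝ (Fin d)) := by
  refine (PiLp.continuous_toLp 2 _).comp (continuous_pi fun i => ?_)
  refine Continuous.div (by fun_prop) ?_ fun θ => (partition_pos θ).ne'
  unfold partition
  fun_prop

/-- The Gibbs variational identity. -/
theorem inner_sub_entropicReg {d : ℕ} [NeZero d] (θ : EuclideanSpace ℝ (Fin d))
    {v : EuclideanSpace ℝ (Fin d)} (hv : v ∈ simplex d) :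
    inner ℝ θ v - entropicReg d v = Real.log (partition θ) - Real.log d -
      ∑ i, softmax θ i * InformationTheory.klFun (v i / softmax θ i) := by
  have hd : (d : ℝ) ≠ 0 := Nat.cast_ne_zero.2 (NeZero.ne d)
  -- The last summand compensates for the affine part of `klFun`; it sums to zero because both
  -- vectors have total mass 1.
  have hterm : ∀ i, v i * θ i - v i * Real.log (d * v i) =
      v i * (Real.log (partition θ) - Real.log d) -
        softmax θ i * InformationTheory.klFun (v i / softmax θ i) + (softmax θ i - v i) := by
    intro i
    have hp := softmax_pos θ i
    have e : softmax θ i * InformationTheory.klFun (v i / softmax θ i) =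
        v i * Real.log (v i / softmax θ i) + softmax θ i - v i := by
      rw [InformationTheory.klFun_apply]
      field_simp
    rw [e]
    rcases eq_or_ne (v i) 0 with h0 | h0
    · simp [h0]
    · rw [Real.log_div h0 hp.ne', Real.log_mul hd h0, softmax_apply,
        Real.log_div (Real.exp_pos _).ne' (partition_pos θ).ne', Real.log_exp]
      ring
  have hsum : ∑ i, v i = 1 := hv.2
  have : inner ℝ θ v - entropicReg d v = ∑ i, (v i * θ i - v i * Real.log (d * v i)) := by
    rw [Finset.sum_sub_distrib, entropicReg]
    simp [PiLp.inner_apply, mul_comm]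
  rw [this]
  simp_rw [hterm]
  rw [Finset.sum_add_distrib, Finset.sum_sub_distrib, Finset.sum_sub_distrib, ← Finset.sum_mul,
    hsum, sum_softmax]
  ring

/-- Relative entropy to the softmax vanishes only at the softmax. Uniqueness of the maximizer also
makes the predictions measurable functions of `θ`. -/
theorem eq_softmax_of_isMaxOn {d : ℕ} [NeZero d] {θ w : EuclideanSpace ℝ (Fin d)}
    (hw : w ∈ simplex d)
    (hmax : IsMaxOn (fun v => inner ℝ θ v - entropicReg d v) (simplex d) w) : w = softmax θ := by
  have h := hmax (softmax_mem_simplex θ)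
  simp only [Set.mem_ofPred_eq] at h
  rw [inner_sub_entropicReg θ hw, inner_sub_entropicReg θ (softmax_mem_simplex θ)] at h
  have hz : ∀ i, softmax θ i / softmax θ i = 1 := fun i => div_self (softmax_pos θ i).ne'
  simp only [hz, InformationTheory.klFun_one, mul_zero, Finset.sum_const_zero] at h
  have hq : ∀ i, 0 ≤ w i / softmax θ i := fun i => div_nonneg (hw.1 i) (softmax_pos θ i).le
  have hnn : ∀ i ∈ Finset.univ, 0 ≤ softmax θ i * InformationTheory.klFun (w i / softmax θ i) :=
    fun i _ => mul_nonneg (softmax_pos θ i).le (InformationTheory.klFun_nonneg (hq i))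
  have h0 := (Finset.sum_eq_zero_iff_of_nonneg hnn).1
    (le_antisymm (by linarith) (Finset.sum_nonneg hnn))
  ext i
  have := (mul_eq_zero.1 (h0 i (Finset.mem_univ i))).resolve_left (softmax_pos θ i).ne'
  rw [InformationTheory.klFun_eq_zero_iff (hq i), div_eq_one_iff_eq (softmax_pos θ i).ne'] at this
  exact this

/-- The right side is the chord of `exp` over `[-B, B]`. -/
theorem exp_le_cosh_add {z B : ℝ} (hB : 0 < B) (hz : |z| ≤ B) :
    Real.exp z ≤ Real.cosh B + z * (Real.sinh B / B) := by
  obtain ⟨h1, h2⟩ := abs_le.1 hz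
  have := convexOn_exp.2 (Set.mem_univ B) (Set.mem_univ (-B))
    (div_nonneg (by linarith : 0 ≤ B + z) (by linarith : 0 ≤ 2 * B))
    (div_nonneg (by linarith : 0 ≤ B - z) (by linarith : 0 ≤ 2 * B)) (by field_simp; ring)
  have e : ((B + z) / (2 * B)) • B + ((B - z) / (2 * B)) • -B = z := by
    simp only [smul_eq_mul]
    field_simp
    ring
  rw [e] at this
  refine this.trans (le_of_eq ?_)
  simp only [smul_eq_mul]
  rw [Real.cosh_eq, Real.sinh_eq]
  field_simp
  ring

/-- Hoeffding's argument: after centering, the deviations are at most `2 b`, the linear part of the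
chord averages to zero, and `cosh (2 b) ≤ exp (2 b²)`. No smallness of `b` is required, hence none
of the step size later. -/
theorem sum_mul_exp_le {ι : Type*} [Fintype ι] {p y : ι → ℝ} {b : ℝ} (hp : ∀ i, 0 ≤ p i)
    (hp1 : ∑ i, p i = 1) (hy : ∀ i, |y i| ≤ b) :
    ∑ i, p i * Real.exp (y i) ≤ Real.exp (∑ i, p i * y i + 2 * b ^ 2) := by
  have hι : Nonempty ι := by
    by_contra h
    have := not_nonempty_iff.1 h
    simp at hp1
  have hb : 0 ≤ b := (abs_nonneg _).trans (hy (Classical.arbitrary ι))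
  rcases hb.eq_or_lt with rfl | hb
  · have : ∀ i, y i = 0 := fun i => abs_nonpos_iff.1 (hy i)
    simp [this, hp1]
  set m := ∑ i, p i * y i with hm
  have hm1 : |m| ≤ b := by
    calc |m| ≤ ∑ i, |p i * y i| := Finset.abs_sum_le_sum_abs _ _
      _ ≤ ∑ i, p i * b := by
          gcongr with i
          rw [abs_mul, abs_of_nonneg (hp i)]
          exact mul_le_mul_of_nonneg_left (hy i) (hp i)
      _ = b := by rw [← Finset.sum_mul, hp1, one_mul]
  have hz : ∀ i, |y i - m| ≤ 2 * b := fun i =>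
    (abs_sub _ _).trans (by linarith [hy i])
  calc ∑ i, p i * Real.exp (y i) = Real.exp m * ∑ i, p i * Real.exp (y i - m) := by
        rw [Finset.mul_sum]
        refine Finset.sum_congr rfl fun i _ => ?_
        rw [Real.exp_sub]
        field_simp
    _ ≤ Real.exp m * ∑ i, p i * (Real.cosh (2 * b) +
          (y i - m) * (Real.sinh (2 * b) / (2 * b))) := by
        gcongr with i
        · exact hp i
        · exact exp_le_cosh_add (by linarith) (hz i)
    _ = Real.exp m * Real.cosh (2 * b) := by
        congr 1
        have : ∀ i, p i * (Real.cosh (2 * b) + (y i - m) * (Real.sinh (2 * b) / (2 * b))) =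
            p i * (Real.cosh (2 * b) - m * (Real.sinh (2 * b) / (2 * b))) +
              p i * y i * (Real.sinh (2 * b) / (2 * b)) := fun i => by ring
        simp_rw [this]
        rw [Finset.sum_add_distrib, ← Finset.sum_mul, ← Finset.sum_mul, hp1, ← hm]
        ring
    _ ≤ Real.exp m * Real.exp (2 * b ^ 2) := by
        gcongr
        refine (Real.cosh_le_exp_half_sq _).trans (le_of_eq ?_)
        ring_nf
    _ = _ := (Real.exp_add _ _).symm

theorem log_partition_step {d : ℕ} [NeZero d] (θ g : EuclideanSpace ℝ (Fin d)) (η : ℝ) :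
    Real.log (partition (θ - η • g)) ≤
      Real.log (partition θ) - η * inner ℝ g (softmax θ) + 2 * η ^ 2 * supNorm g ^ 2 := by
  have h := sum_mul_exp_le (p := fun i => softmax θ i) (y := fun i => -η * g i)
    (b := |η| * supNorm g) (fun i => (softmax_pos θ i).le) (sum_softmax θ) fun i => by
      rw [abs_mul, abs_neg]
      exact mul_le_mul_of_nonneg_left (abs_apply_le_supNorm g i) (abs_nonneg η)
  have e1 : ∑ i, softmax θ i * Real.exp (-η * g i) = partition (θ - η • g) / partition θ := by
    conv_rhs => rw [partition, Finset.sum_div]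
    refine Finset.sum_congr rfl fun i _ => ?_
    rw [softmax_apply, div_mul_eq_mul_div, ← Real.exp_add]
    simp [sub_eq_add_neg]
  have e2 : ∑ i, softmax θ i * (-η * g i) = -η * inner ℝ g (softmax θ) := by
    rw [PiLp.inner_apply, Finset.mul_sum]
    refine Finset.sum_congr rfl fun i _ => ?_
    simp
    ring
  rw [e1, e2, ← Real.log_le_iff_le_exp (div_pos (partition_pos _) (partition_pos _)),
    Real.log_div (partition_pos _).ne' (partition_pos _).ne', mul_pow, sq_abs] at h
  linarith

theorem inner_le_log_partition {d : ℕ} [NeZero d] (θ : EuclideanSpace ℝ (Fin d))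
    {v : EuclideanSpace ℝ (Fin d)} (hv : v ∈ simplex d) :
    inner ℝ θ v ≤ Real.log (partition θ) := by
  have hi : ∀ i, θ i ≤ Real.log (partition θ) := fun i => by
    rw [Real.le_log_iff_exp_le (partition_pos θ)]
    exact Finset.single_le_sum (f := fun i => Real.exp (θ i)) (fun _ _ => (Real.exp_pos _).le)
      (Finset.mem_univ i)
  calc inner ℝ θ v = ∑ i, v i * θ i := by simp [PiLp.inner_apply]
    _ ≤ ∑ i, v i * Real.log (partition θ) := by
        gcongr with i
        · exact hv.1 i
        · exact hi i
    _ = _ := by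
        rw [← Finset.sum_mul, show ∑ i, v i = 1 from hv.2, one_mul]

/-- The regret bound for exponential weights with linear losses. -/
theorem IsRun.sum_inner_le {d : ℕ} [NeZero d] {η : ℝ} {δ : ℕ → ℝ} {T : ℕ}
    {f : ℕ → EuclideanSpace ℝ (Fin d) → ℝ} {u θ w : ℕ → EuclideanSpace ℝ (Fin d)}
    (h : IsRun (simplex d) (entropicReg d) η δ T f u θ w) (hη : 0 < η)
    {v : EuclideanSpace ℝ (Fin d)} (hv : v ∈ simplex d) :
    ∑ t ∈ Finset.range T, inner ℝ (gradEstimate (δ t) (f t) (w t) (u t)) (w t - v) ≤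
      Real.log d / η + 2 * η *
        ∑ t ∈ Finset.range T, supNorm (gradEstimate (δ t) (f t) (w t) (u t)) ^ 2 := by
  set g : ℕ → EuclideanSpace ℝ (Fin d) := fun t => gradEstimate (δ t) (f t) (w t) (u t) with hg
  -- The potential `log (partition (θ n)) - ⟨θ n, v⟩` starts at `log d` and is nonnegative at time
  -- `T`; its increments telescope.
  have key : ∀ n ≤ T, Real.log (partition (θ n)) - inner ℝ (θ n) v ≤ Real.log d -
      η * ∑ t ∈ Finset.range n, inner ℝ (g t) (w t - v) +
        2 * η ^ 2 * ∑ t ∈ Finset.range n, supNorm (g t) ^ 2 := by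
    intro n
    induction n with
    | zero => simp [h.init, partition]
    | succ n ih =>
      intro hn
      have ih := ih (by lia)
      have hstep := log_partition_step (θ n) (g n) η
      rw [← eq_softmax_of_isMaxOn (h.predict_mem n hn) (h.predict_max n hn), hg,
        ← h.update n hn] at hstep
      have hin : inner ℝ (θ (n + 1)) v = inner ℝ (θ n) v - η * inner ℝ (g n) v := by
        rw [h.update n hn, inner_sub_left, real_inner_smul_left]
      rw [Finset.sum_range_succ, Finset.sum_range_succ, hin, inner_sub_right]
      simp only [hg] at ih hstep ⊢
      linarith
  have hT := key T le_rfl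
  have hv' := inner_le_log_partition (θ T) hv
  refine le_of_mul_le_mul_left ?_ hη
  have e : η * (Real.log d / η + 2 * η * ∑ t ∈ Finset.range T, supNorm (g t) ^ 2) =
      Real.log d + 2 * η ^ 2 * ∑ t ∈ Finset.range T, supNorm (g t) ^ 2 := by
    field_simp
  rw [e]
  linarith

/-! ### One round of the game -/

theorem supNorm_le_norm {d : ℕ} (u : EuclideanSpace ℝ (Fin d)) : supNorm u ≤ ‖u‖ :=
  (pi_norm_le_iff_of_nonneg (norm_nonneg u)).2 fun i => PiLp.norm_apply_le u i

theorem abs_inner_le {d : ℕ} (g x : EuclideanSpace ℝ (Fin d)) :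
    |inner ℝ g x| ≤ supNorm g * ∑ i, |x i| := by
  rw [PiLp.inner_apply, Finset.mul_sum]
  refine (Finset.abs_sum_le_sum_abs _ _).trans (Finset.sum_le_sum fun i _ => ?_)
  have : |inner ℝ (g i) (x i)| = |g i| * |x i| := by simp [abs_mul, mul_comm]
  rw [this]
  exact mul_le_mul_of_nonneg_right (abs_apply_le_supNorm g i) (abs_nonneg _)

theorem sum_abs_sub_le_two {d : ℕ} {x y : EuclideanSpace ℝ (Fin d)} (hx : x ∈ simplex d)
    (hy : y ∈ simplex d) : ∑ i, |x i - y i| ≤ 2 := by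
  calc ∑ i, |x i - y i| ≤ ∑ i, (x i + y i) := by
        gcongr with i
        have h1 : 0 ≤ x i := hx.1 i
        have h2 : 0 ≤ y i := hy.1 i
        rw [abs_le]
        constructor <;> linarith
    _ = 2 := by
        rw [Finset.sum_add_distrib, show ∑ i, x i = 1 from hx.2, show ∑ i, y i = 1 from hy.2]
        norm_num

/-- A crude uniform bound, serving only for integrability. -/
theorem supNorm_gradEstimate_le {d : ℕ} {G δ : ℝ} {f : EuclideanSpace ℝ (Fin d) → ℝ}
    (hf : IsLipschitzL1 G f) (hG : 0 ≤ G) (hδ : 0 < δ) (x u : EuclideanSpace ℝ (Fin d))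
    (hu : ‖u‖ = 1) : supNorm (gradEstimate δ f x u) ≤ d * G * Real.sqrt d := by
  have h1 := hf.abs_symmDiff_le hG x u hδ.le hu
  have h2 : supNorm u ≤ 1 := hu ▸ supNorm_le_norm u
  rw [gradEstimate, supNorm_smul, abs_mul, abs_of_nonneg (by positivity : 0 ≤ d / (2 * δ))]
  calc _ ≤ d / (2 * δ) * (2 * (δ * G * Real.sqrt d)) * 1 := by
        gcongr
        exact supNorm_nonneg u
    _ = _ := by field_simp

/-- Continuity in the point and measurability in the parameter give joint measurability, needed to
evaluate a random loss at a random point. -/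
theorem measurable_uncurry_loss {d : ℕ} {S : Type*} [MeasurableSpace S]
    {F : S → EuclideanSpace ℝ (Fin d) → ℝ} (hF : ∀ x, Measurable fun s => F s x)
    (hFc : ∀ s, Continuous (F s)) :
    Measurable fun p : S × EuclideanSpace ℝ (Fin d) => F p.1 p.2 :=
  (measurable_uncurry_of_continuous_of_measurable (u := fun x s => F s x) hFc hF).comp
    measurable_swap

theorem measurable_gradEstimate {d : ℕ} {S : Type*} [MeasurableSpace S] (δ : ℝ)
    {F : S → EuclideanSpace ℝ (Fin d) → ℝ} (hF : ∀ x, Measurable fun s => F s x)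
    (hFc : ∀ s, Continuous (F s)) {W U : S → EuclideanSpace ℝ (Fin d)} (hW : Measurable W)
    (hU : Measurable U) : Measurable fun s => gradEstimate δ (F s) (W s) (U s) := by
  have h := measurable_uncurry_loss hF hFc
  have h1 : Measurable fun s => F s (W s + δ • U s) :=
    h.comp (measurable_id.prodMk (hW.add (hU.const_smul δ)))
  have h2 : Measurable fun s => F s (W s - δ • U s) :=
    h.comp (measurable_id.prodMk (hW.sub (hU.const_smul δ)))
  exact ((h1.sub h2).const_mul _).smul hU

/-- Integrating out a uniform direction that is independent of the past. -/
theorem integral_comp_of_indepFun {d : ℕ} [NeZero d] {S Ω : Type*} [MeasurableSpace S]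
    [MeasurableSpace Ω] {μ : Measure Ω} [IsProbabilityMeasure μ] {X : Ω → S}
    {u : Ω → EuclideanSpace ℝ (Fin d)} (hX : Measurable X) (hu : Measurable u)
    (hlaw : μ.map u = uniformSphere d) (hind : IndepFun X u μ)
    {Φ : S → EuclideanSpace ℝ (Fin d) → ℝ}
    (hΦ : Measurable fun p : S × EuclideanSpace ℝ (Fin d) => Φ p.1 p.2) {K : ℝ}
    (hK : ∀ s v, ‖v‖ = 1 → |Φ s v| ≤ K) :
    Integrable (fun ω => Φ (X ω) (u ω)) μ ∧
      Integrable (fun ω => ∫ v, Φ (X ω) v ∂(uniformSphere d)) μ ∧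
      ∫ ω, Φ (X ω) (u ω) ∂μ = ∫ ω, ∫ v, Φ (X ω) v ∂(uniformSphere d) ∂μ := by
  have hXu : Measurable fun ω => (X ω, u ω) := hX.prodMk hu
  have hmap : μ.map (fun ω => (X ω, u ω)) = (μ.map X).prod (uniformSphere d) := by
    rw [(indepFun_iff_map_prod_eq_prod_map_map hX.aemeasurable hu.aemeasurable).1 hind, hlaw]
  have : IsProbabilityMeasure (μ.map X) := Measure.isProbabilityMeasure_map hX.aemeasurable
  have hint : Integrable (fun p : S × EuclideanSpace ℝ (Fin d) => Φ p.1 p.2)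
      ((μ.map X).prod (uniformSphere d)) := by
    refine Integrable.of_bound hΦ.aestronglyMeasurable K ?_
    filter_upwards [Measure.quasiMeasurePreserving_snd.ae (ae_norm_eq_one d)] with p hp
    exact hK _ _ hp
  have hint' := hint.integral_prod_left
  refine ⟨?_, hint'.comp_measurable hX, ?_⟩
  · rw [← hmap] at hint
    exact hint.comp_measurable hXu
  · calc _ = ∫ p, Φ p.1 p.2 ∂(μ.map fun ω => (X ω, u ω)) :=
          (integral_map hXu.aemeasurable hΦ.aestronglyMeasurable).symm
      _ = ∫ s, ∫ v, Φ s v ∂(uniformSphere d) ∂(μ.map X) := by rw [hmap, integral_prod _ hint]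
      _ = _ := integral_map hX.aemeasurable hint'.aestronglyMeasurable

theorem integral_loss_sub_le {d : ℕ} [NeZero d] {S Ω : Type*} [mS : MeasurableSpace S]
    [MeasurableSpace Ω] {μ : Measure Ω} [IsProbabilityMeasure μ] {X : Ω → S}
    {u : Ω → EuclideanSpace ℝ (Fin d)} (hX : Measurable X) (hu : Measurable u)
    (hlaw : μ.map u = uniformSphere d) (hind : IndepFun X u μ) {G δ : ℝ} (hG : 0 ≤ G) (hδ : 0 < δ)
    {F : S → EuclideanSpace ℝ (Fin d) → ℝ} (hF : ∀ x, Measurable fun s => F s x)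
    (hconv : ∀ s, ConvexOn ℝ Set.univ (F s)) (hlip : ∀ s, IsLipschitzL1 G (F s))
    {W : S → EuclideanSpace ℝ (Fin d)} (hW : Measurable W) (hWs : ∀ s, W s ∈ simplex d)
    {y : EuclideanSpace ℝ (Fin d)} (hy : y ∈ simplex d) :
    Integrable (fun ω => F (X ω) (W (X ω)) - F (X ω) y) μ ∧
      Integrable (fun ω => inner ℝ (gradEstimate δ (F (X ω)) (W (X ω)) (u ω)) (W (X ω) - y)) μ ∧
      ∫ ω, (F (X ω) (W (X ω)) - F (X ω) y) ∂μ ≤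
        ∫ ω, inner ℝ (gradEstimate δ (F (X ω)) (W (X ω)) (u ω)) (W (X ω) - y) ∂μ +
          2 * (δ * G * Real.sqrt d) := by
  have hFc := fun s => (hlip s).continuous
  have hloss := measurable_uncurry_loss hF hFc
  have hD : Integrable (fun ω => F (X ω) (W (X ω)) - F (X ω) y) μ := by
    have hm : Measurable fun s => F s (W s) - F s y :=
      (hloss.comp (measurable_id.prodMk hW)).sub (hF y)
    refine Integrable.of_bound (hm.comp hX).aestronglyMeasurable (G * 2)
      (Filter.Eventually.of_forall fun ω => ?_)
    exact (hlip _ _ _).trans (mul_le_mul_of_nonneg_left (sum_abs_sub_le_two (hWs _) hy) hG)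
  have hg : Measurable fun p : S × EuclideanSpace ℝ (Fin d) =>
      gradEstimate δ (F p.1) (W p.1) p.2 :=
    measurable_gradEstimate δ (fun x => (hF x).comp measurable_fst) (fun p => hFc p.1)
      (hW.comp measurable_fst) measurable_snd
  obtain ⟨h1, h2, h3⟩ := integral_comp_of_indepFun hX hu hlaw hind
    (Φ := fun s v => inner ℝ (gradEstimate δ (F s) (W s) v) (W s - y))
    (hg.inner ((hW.comp measurable_fst).sub measurable_const)) (K := d * G * Real.sqrt d * 2)
    fun s v hv => (abs_inner_le _ _).trans (mul_le_mul
      (supNorm_gradEstimate_le (hlip s) hG hδ _ _ hv) (sum_abs_sub_le_two (hWs s) hy)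
      (Finset.sum_nonneg fun _ _ => abs_nonneg _) (by positivity))
  refine ⟨hD, h1, ?_⟩
  rw [h3]
  calc _ ≤ ∫ ω, (∫ v, inner ℝ (gradEstimate δ (F (X ω)) (W (X ω)) v) (W (X ω) - y)
        ∂(uniformSphere d) + 2 * (δ * G * Real.sqrt d)) ∂μ :=
        integral_mono hD (h2.add (integrable_const _)) fun ω =>
          sub_le_integral_inner_gradEstimate (hconv _) (hlip _) hG hδ _ _
    _ = _ := by
        rw [integral_add h2 (integrable_const _)]
        simp

theorem integral_supNorm_gradEstimate_sq_comp_le {d : ℕ} [NeZero d] {S Ω : Type*}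
    [mS : MeasurableSpace S] [MeasurableSpace Ω] {μ : Measure Ω} [IsProbabilityMeasure μ]
    {X : Ω → S} {u : Ω → EuclideanSpace ℝ (Fin d)} (hX : Measurable X) (hu : Measurable u)
    (hlaw : μ.map u = uniformSphere d) (hind : IndepFun X u μ) {G δ : ℝ} (hG : 0 ≤ G) (hδ : 0 < δ)
    {F : S → EuclideanSpace ℝ (Fin d) → ℝ} (hF : ∀ x, Measurable fun s => F s x)
    (hlip : ∀ s, IsLipschitzL1 G (F s)) {W : S → EuclideanSpace ℝ (Fin d)} (hW : Measurable W) :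
    Integrable (fun ω => supNorm (gradEstimate δ (F (X ω)) (W (X ω)) (u ω)) ^ 2) μ ∧
      ∫ ω, supNorm (gradEstimate δ (F (X ω)) (W (X ω)) (u ω)) ^ 2 ∂μ ≤
        d ^ 2 * G ^ 2 * supNormFourthMoment d ^ 2 := by
  have hg : Measurable fun p : S × EuclideanSpace ℝ (Fin d) =>
      gradEstimate δ (F p.1) (W p.1) p.2 :=
    measurable_gradEstimate δ (fun x => (hF x).comp measurable_fst)
      (fun p => (hlip p.1).continuous) (hW.comp measurable_fst) measurable_snd
  obtain ⟨h1, h2, h3⟩ := integral_comp_of_indepFun hX hu hlaw hind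
    (Φ := fun s v => supNorm (gradEstimate δ (F s) (W s) v) ^ 2)
    ((continuous_supNorm.measurable.comp hg).pow_const 2) (K := (d * G * Real.sqrt d) ^ 2)
    fun s v hv => by
      rw [abs_of_nonneg (sq_nonneg _)]
      exact pow_le_pow_left₀ (supNorm_nonneg _)
        (supNorm_gradEstimate_le (hlip s) hG hδ _ _ hv) 2
  refine ⟨h1, ?_⟩
  rw [h3]
  calc _ ≤ ∫ _, d ^ 2 * G ^ 2 * supNormFourthMoment d ^ 2 ∂μ :=
        integral_mono h2 (integrable_const _) fun ω =>
          integral_supNorm_gradEstimate_sq_le (hlip _) hδ _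
    _ = _ := by simp

/-! ### The whole game -/

theorem measurable_iterate {d : ℕ} [NeZero d] {Ω : Type*} [mΩ : MeasurableSpace Ω] {μ : Measure Ω}
    {ℱ : Filtration ℕ mΩ} {T : ℕ} {G η : ℝ} {δ : ℕ → ℝ}
    {f : ℕ → Ω → EuclideanSpace ℝ (Fin d) → ℝ} {u θ w : ℕ → Ω → EuclideanSpace ℝ (Fin d)}
    (hlip : ∀ t < T, ∀ ω, IsLipschitzL1 G (f t ω)) (hgame : IsGame μ ℱ T f u)
    (hrun : ∀ ω, IsRun (simplex d) (entropicReg d) η δ T (fun t => f t ω) (fun t => u t ω)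
      (fun t => θ t ω) (fun t => w t ω)) :
    ∀ t ≤ T, Measurable[ℱ t] (θ t) := by
  intro t
  induction t with
  | zero =>
    intro _
    have : θ 0 = fun _ => 0 := funext fun ω => (hrun ω).init
    rw [this]
    exact measurable_const
  | succ t ih =>
    intro ht
    have hle : ℱ t ≤ ℱ (t + 1) := ℱ.mono (Nat.le_succ t)
    have hθ : Measurable[ℱ (t + 1)] (θ t) := (ih (by lia)).mono hle le_rfl
    have hw : w t = fun ω => softmax (θ t ω) := funext fun ω =>
      eq_softmax_of_isMaxOn ((hrun ω).predict_mem t ht) ((hrun ω).predict_max t ht)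
    have hwm : Measurable[ℱ (t + 1)] (w t) := by
      rw [hw]
      exact continuous_softmax.measurable.comp hθ
    have hg := @measurable_gradEstimate d Ω (ℱ (t + 1)) (δ t) (f t)
      (fun x => (hgame.loss_measurable t ht x).mono hle le_rfl)
      (fun ω => (hlip t ht ω).continuous) (w t) (u t) hwm (hgame.dir_measurable t ht)
    have : θ (t + 1) = fun ω => θ t ω - η • gradEstimate (δ t) (f t ω) (w t ω) (u t ω) :=
      funext fun ω => (hrun ω).update t ht
    rw [this]
    exact hθ.sub (hg.const_smul η)

theorem expected_regret_le {d : ℕ} [NeZero d] {Ω : Type*} [mΩ : MeasurableSpace Ω] {μ : Measure Ω}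
    [IsProbabilityMeasure μ] {ℱ : Filtration ℕ mΩ} {T : ℕ} {G η : ℝ} {δ : ℕ → ℝ}
    {f : ℕ → Ω → EuclideanSpace ℝ (Fin d) → ℝ} {u θ w : ℕ → Ω → EuclideanSpace ℝ (Fin d)}
    (hG : 0 ≤ G) (hη : 0 < η) (hδ : ∀ t < T, 0 < δ t)
    (hconv : ∀ t < T, ∀ ω, ConvexOn ℝ Set.univ (f t ω))
    (hlip : ∀ t < T, ∀ ω, IsLipschitzL1 G (f t ω)) (hgame : IsGame μ ℱ T f u)
    (hrun : ∀ ω, IsRun (simplex d) (entropicReg d) η δ T (fun t => f t ω) (fun t => u t ω)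
      (fun t => θ t ω) (fun t => w t ω))
    {y : EuclideanSpace ℝ (Fin d)} (hy : y ∈ simplex d) :
    Integrable (fun ω => ∑ t ∈ Finset.range T, (f t ω (w t ω) - f t ω y)) μ ∧
      ∫ ω, ∑ t ∈ Finset.range T, (f t ω (w t ω) - f t ω y) ∂μ ≤
        Real.log d / η + 2 * η * (T * (d ^ 2 * G ^ 2 * supNormFourthMoment d ^ 2)) +
          ∑ t ∈ Finset.range T, 2 * (δ t * G * Real.sqrt d) := by
  have hwm : ∀ t < T, Measurable[ℱ t] (w t) := fun t ht => by
    have hw : w t = fun ω => softmax (θ t ω) := funext fun ω =>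
      eq_softmax_of_isMaxOn ((hrun ω).predict_mem t ht) ((hrun ω).predict_max t ht)
    rw [hw]
    exact continuous_softmax.measurable.comp (measurable_iterate hlip hgame hrun t ht.le)
  have hum : ∀ t < T, Measurable (u t) := fun t ht =>
    (hgame.dir_measurable t ht).mono (ℱ.le _) le_rfl
  -- The past is modelled as the identity map from `Ω` to `Ω` with the σ-algebra `ℱ t`; its
  -- independence from `u t` is then exactly `dir_indep`.
  have hid : ∀ t, @Measurable Ω Ω mΩ (ℱ t) id := fun t => measurable_id.mono le_rfl (ℱ.le t)
  have hind : ∀ t < T, @IndepFun Ω Ω _ mΩ (ℱ t) _ id (u t) μ := fun t ht => by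
    rw [@IndepFun_iff_Indep _ _ _ mΩ (ℱ t), MeasurableSpace.comap_id]
    exact (hgame.dir_indep t ht).symm
  have h1 := fun t (ht : t < T) => integral_loss_sub_le (mS := ℱ t) (hid t) (hum t ht)
    (hgame.dir_law t ht) (hind t ht) hG (hδ t ht) (hgame.loss_measurable t ht) (hconv t ht)
    (hlip t ht) (hwm t ht) (fun ω => (hrun ω).predict_mem t ht) hy
  have h2 := fun t (ht : t < T) => integral_supNorm_gradEstimate_sq_comp_le (mS := ℱ t) (hid t)
    (hum t ht) (hgame.dir_law t ht) (hind t ht) hG (hδ t ht) (hgame.loss_measurable t ht)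
    (hlip t ht) (hwm t ht)
  simp only [id] at h1 h2
  have hD : ∀ t ∈ Finset.range T, Integrable (fun ω => f t ω (w t ω) - f t ω y) μ :=
    fun t ht => (h1 t (Finset.mem_range.1 ht)).1
  have hI : ∀ t ∈ Finset.range T, Integrable
      (fun ω => inner ℝ (gradEstimate (δ t) (f t ω) (w t ω) (u t ω)) (w t ω - y)) μ :=
    fun t ht => (h1 t (Finset.mem_range.1 ht)).2.1
  have hN : ∀ t ∈ Finset.range T, Integrable
      (fun ω => supNorm (gradEstimate (δ t) (f t ω) (w t ω) (u t ω)) ^ 2) μ :=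
    fun t ht => (h2 t (Finset.mem_range.1 ht)).1
  have hreg : ∑ t ∈ Finset.range T,
      ∫ ω, inner ℝ (gradEstimate (δ t) (f t ω) (w t ω) (u t ω)) (w t ω - y) ∂μ ≤
      Real.log d / η + 2 * η * ∑ t ∈ Finset.range T,
        ∫ ω, supNorm (gradEstimate (δ t) (f t ω) (w t ω) (u t ω)) ^ 2 ∂μ := by
    have hNs := integrable_finsetSum _ hN
    calc _ = ∫ ω, ∑ t ∈ Finset.range T,
          inner ℝ (gradEstimate (δ t) (f t ω) (w t ω) (u t ω)) (w t ω - y) ∂μ :=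
          (integral_finsetSum _ hI).symm
      _ ≤ ∫ ω, (Real.log d / η + 2 * η * ∑ t ∈ Finset.range T,
          supNorm (gradEstimate (δ t) (f t ω) (w t ω) (u t ω)) ^ 2) ∂μ :=
          integral_mono (integrable_finsetSum _ hI) ((integrable_const _).add (hNs.const_mul _))
            fun ω => (hrun ω).sum_inner_le hη hy
      _ = _ := by
          rw [integral_add (integrable_const _) (hNs.const_mul _), integral_const_mul,
            integral_finsetSum _ hN]
          simp
  have hvar : ∑ t ∈ Finset.range T,
      ∫ ω, supNorm (gradEstimate (δ t) (f t ω) (w t ω) (u t ω)) ^ 2 ∂μ ≤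
      T * (d ^ 2 * G ^ 2 * supNormFourthMoment d ^ 2) := by
    refine (Finset.sum_le_sum fun t ht => (h2 t (Finset.mem_range.1 ht)).2).trans ?_
    simp
  refine ⟨integrable_finsetSum _ hD, ?_⟩
  rw [integral_finsetSum _ hD]
  calc _ ≤ ∑ t ∈ Finset.range T,
        (∫ ω, inner ℝ (gradEstimate (δ t) (f t ω) (w t ω) (u t ω)) (w t ω - y) ∂μ +
          2 * (δ t * G * Real.sqrt d)) :=
        Finset.sum_le_sum fun t ht => (h1 t (Finset.mem_range.1 ht)).2.2
    _ ≤ _ := by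
        rw [Finset.sum_add_distrib]
        have := mul_le_mul_of_nonneg_left hvar (by positivity : 0 ≤ 2 * η)
        linarith

end TwoPointBandit

/-! ### Tuning the parameters. -/

theorem mainTheorem4 :
    (∃ c₀ : ℝ, 0 < c₀ ∧ ∀ d : ℕ, 2 ≤ d →
      TwoPointBandit.supNormFourthMoment d ≤ c₀ * Real.sqrt (Real.log d / d)) ∧
    ∀ C : ℝ, ∃ c : ℝ, 0 < c ∧
      ∀ (d T : ℕ), 2 ≤ d → 1 ≤ T →
      ∀ (G p R η : ℝ) (δ : ℕ → ℝ), 0 < G →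
        TwoPointBandit.supNormFourthMoment d ≤ p → p ≤ C * Real.sqrt (Real.log d / d) →
        R = Real.sqrt (Real.log d) →
        η = R / (p * (Real.sqrt d * G) * Real.sqrt (d * T)) →
        (∀ t < T, 0 < δ t ∧ δ t ≤ p * R * Real.sqrt (d / T)) →
      ∀ {Ω : Type*} [mΩ : MeasurableSpace Ω] (μ : Measure Ω) [IsProbabilityMeasure μ]
        (ℱ : Filtration ℕ mΩ)
        (f : ℕ → Ω → EuclideanSpace ℝ (Fin d) → ℝ)
        (u θ w : ℕ → Ω → EuclideanSpace ℝ (Fin d)),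
        (∀ t < T, ∀ ω, ConvexOn ℝ Set.univ (f t ω)) →
        (∀ t < T, ∀ ω, TwoPointBandit.IsLipschitzL1 G (f t ω)) →
        TwoPointBandit.IsGame μ ℱ T f u →
        (∀ ω, TwoPointBandit.IsRun (TwoPointBandit.simplex d) (TwoPointBandit.entropicReg d)
          η δ T (fun t => f t ω) (fun t => u t ω) (fun t => θ t ω) (fun t => w t ω)) →
      ∀ wstar ∈ TwoPointBandit.simplex d,
        Integrable (fun ω => (1 / (T : ℝ)) * ∑ t ∈ Finset.range T, f t ω (w t ω)
          - (1 / (T : ℝ)) * ∑ t ∈ Finset.range T, f t ω wstar) μ ∧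
        ∫ ω, ((1 / (T : ℝ)) * ∑ t ∈ Finset.range T, f t ω (w t ω)
          - (1 / (T : ℝ)) * ∑ t ∈ Finset.range T, f t ω wstar) ∂μ
          ≤ c * G * Real.sqrt (d * (Real.log d) ^ 2 / T) := by
  -- The three regret terms are at most 1, 2 and 2 times `p R d G √T`, whence 5; `max C 1` keeps the
  -- constant positive.
  refine ⟨TwoPointBandit.supNormFourthMoment_le, fun C => ⟨5 * max C 1, by positivity, ?_⟩⟩
  intro d T hd hT G p R η δ hG hmp hpC hR hη hδ Ω mΩ μ _ ℱ f u θ w hconv hlip hgame hrun wstar hws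
  have : NeZero d := ⟨by lia⟩
  have hd0 : (0 : ℝ) < d := Nat.cast_pos.2 (by lia)
  have hT0 : (0 : ℝ) < T := Nat.cast_pos.2 (by lia)
  have hL : 0 < Real.log d := Real.log_pos (by exact_mod_cast (by lia : 1 < d))
  have hR0 : 0 < R := hR ▸ Real.sqrt_pos.2 hL
  have hRR : R ^ 2 = Real.log d := hR ▸ Real.sq_sqrt hL.le
  have hm0 := TwoPointBandit.supNormFourthMoment_nonneg d
  have hp : 0 < p := by
    refine (hm0.trans hmp).lt_of_ne ?_
    -- If `p` were zero, no positive `δ 0` would be admissible.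
    rintro rfl
    obtain ⟨h1, h2⟩ := hδ 0 (by lia)
    rw [zero_mul, zero_mul] at h2
    linarith
  set D := Real.sqrt d with hD
  set τ := Real.sqrt T with hτ
  have hD0 : 0 < D := Real.sqrt_pos.2 hd0
  have hτ0 : 0 < τ := Real.sqrt_pos.2 hT0
  have hDD : D ^ 2 = d := Real.sq_sqrt hd0.le
  have hττ : τ ^ 2 = T := Real.sq_sqrt hT0.le
  rw [Real.sqrt_mul hd0.le, ← hD, ← hτ] at hη
  have hη0 : 0 < η := hη ▸ by positivity
  obtain ⟨hint, hreg⟩ := TwoPointBandit.expected_regret_le hG.le hη0 (fun t ht => (hδ t ht).1)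
    hconv hlip hgame hrun hws
  have hrw : ∀ ω, (1 / (T : ℝ)) * ∑ t ∈ Finset.range T, f t ω (w t ω)
      - (1 / (T : ℝ)) * ∑ t ∈ Finset.range T, f t ω wstar =
      (1 / (T : ℝ)) * ∑ t ∈ Finset.range T, (f t ω (w t ω) - f t ω wstar) := fun ω => by
    rw [Finset.sum_sub_distrib, mul_sub]
  simp_rw [hrw]
  refine ⟨hint.const_mul _, ?_⟩
  rw [integral_const_mul]
  have hδs : ∑ t ∈ Finset.range T, 2 * (δ t * G * D) ≤ 2 * (p * R * D ^ 2 * G * τ) := by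
    calc _ ≤ ∑ t ∈ Finset.range T, 2 * (p * R * (D / τ) * G * D) := by
          gcongr with t ht
          rw [hD, hτ, ← Real.sqrt_div hd0.le]
          exact (hδ t (Finset.mem_range.1 ht)).2
      _ = τ ^ 2 * (2 * (p * R * (D / τ) * G * D)) := by simp [hττ]
      _ = _ := by field_simp
  have hfirst : Real.log d / η = p * R * D ^ 2 * G * τ := by
    rw [← hRR, hη]
    field_simp
  have hsecond : 2 * η * (T * (d ^ 2 * G ^ 2 * TwoPointBandit.supNormFourthMoment d ^ 2)) ≤
      2 * (p * R * D ^ 2 * G * τ) := by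
    calc _ ≤ 2 * η * (T * (d ^ 2 * G ^ 2 * p ^ 2)) := by gcongr
      _ = _ := by
        rw [← hττ, ← hDD, hη]
        field_simp
  have hpb : p ≤ max C 1 * (R / D) := by
    rw [hR, hD, ← Real.sqrt_div hL.le]
    refine hpC.trans ?_
    gcongr
    exact le_max_left _ _
  have htarget : Real.sqrt (d * Real.log d ^ 2 / T) = D * R ^ 2 / τ := by
    rw [Real.sqrt_div (by positivity), Real.sqrt_mul hd0.le, Real.sqrt_sq hL.le, hRR]
  rw [htarget]
  calc _ ≤ 1 / (T : ℝ) * (5 * (p * R * D ^ 2 * G * τ)) := by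
        gcongr
        linarith
    _ ≤ 1 / (T : ℝ) * (5 * (max C 1 * (R / D) * R * D ^ 2 * G * τ)) := by gcongr
    _ = _ := by
        rw [← hττ]
        field_simp
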